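/- Let $R$ be a commutative ring and let $F(x,y)\in R[[x,y]]$ be a one-dimensional commutative formal group law which is normal, i.e. its formal inverse is $\imath_F(x)=\frac{x}{x-1}$. Let $\Lambda$ be a lattice (a free abelian group of finite rank) with a root datum $\Sigma\hookrightarrow\Lambda^\vee$, $\alpha\mapsto\alpha^\vee$, $\Sigma\subset\Lambda$ finite, let $\{\alpha_1,\dots,\alpha_n\}$ be a basis of simple roots, write $(\alpha^\vee,\lambda)=\alpha^\vee(\lambda)$ and $s_\alpha(\lambda)=\lambda-\alpha^\vee(\lambda)\alpha$, and let $W$ be the Weyl group, generated by the $s_\alpha$; put $s_i=s_{\alpha_i}$ and let $m_{ij}$ be the order of $s_is_j$. Let $R[[x_\Lambda]]$ be the completion of the polynomial ring $R[x_\lambda\mid\lambda\in\Lambda]$ at the kernel of the augmentation $x_\lambda\mapsto0$, and let $R[[\Lambda]]_F$ be its quotient by the closure of the ideal generated by $x_0$ and all $x_{\lambda+\mu}-F(x_\lambda,x_\mu)$; $W$ acts on it by $w(x_\lambda)=x_{w(\lambda)}$. Assume that $x_\alpha$ is a non-zero-divisor in $R[[\Lambda]]_F$ for every root $\alpha$.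 Let $Q=R[[\Lambda]]_F[\frac1{x_\alpha}\mid\alpha\in\Sigma]$, with the induced action of $W$, and let $Q_W$ be the free left $Q$-module with basis $\{\delta_w\}_{w\in W}$ and the multiplication $q\delta_w\cdot q'\delta_{w'}=q\,w(q')\,\delta_{ww'}$. Put $X_\alpha=\frac1{x_\alpha}(1-\delta_{s_\alpha})$ and let the formal affine Demazure algebra $\mathbf D_F$ be the $R$-subalgebra of $Q_W$ generated by $R[[\Lambda]]_F$ and all $X_\alpha$, $\alpha\in\Sigma$. Write $X_i=X_{\alpha_i}$ and $X_{i_1\cdots i_l}=X_{i_1}\cdots X_{i_l}$. For roots $\lambda,\mu$ whose sum is a root put $$\kappa_{\lambda,\mu}=\frac1{x_{\lambda+\mu}x_\mu}-\frac1{x_{\lambda+\mu}x_{-\lambda}}-\frac1{x_\lambda x_\mu}\in Q,$$ and write $\kappa_{ij}=\kappa_{\alpha_i,\alpha_j}$, $\kappa_{j,i+j}=\kappa_{\alpha_j,\alpha_i+\alpha_j}$. Then the following hold in $\mathbf D_F$. (1) $X_\alpha^2=X_\alpha$ for every root $\alpha$. (2) If $(\alpha_i^\vee,\alpha_j)=(\alpha_j^\vee,\alpha_i)=-1$,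 then $m_{ij}=3$, the element $\kappa_{ij}$ lies in $R[[\Lambda]]_F$ and is invariant under $s_i$ and $s_j$, and $$X_{jij}-X_{iji}=(X_i-X_j)\,\kappa_{ij}.$$ (3) If $(\alpha_i^\vee,\alpha_j)=-1$ and $(\alpha_j^\vee,\alpha_i)=-2$, then $m_{ij}=4$, the element $\kappa_{ij}+\kappa_{j,i+j}$ lies in $R[[\Lambda]]_F$ and is invariant under $s_i$ and $s_j$, and $$X_{jiji}-X_{ijij}=(X_{ij}-X_{ji})\,(\kappa_{ij}+\kappa_{j,i+j}).$$ -/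

import Mathlib

noncomputable section

namespace FormalDemazure

/-! ### Normal formal group laws -/

/-- The power series `inv` is the formal inverse of the formal group law `F`: it has no constant
term and `F(x, inv(x)) = 0`. -/
structure IsFormalInverse {R : Type*} [CommRing R] (F : FormalGroup R) (inv : PowerSeries R) :
    Prop where
  constantCoeff_eq_zero : PowerSeries.constantCoeff inv = 0
  subst_eq_zero :
    MvPowerSeries.subst ![(PowerSeries.X : PowerSeries R), inv] F.toPowerSeries =
      (0 : PowerSeries R)

/-- `F` is normal if its formal inverse is `x / (x - 1)`; as `x - 1` is invertible in `R⟦x⟧`, this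
is the power series `inv` with `(x - 1) * inv = x`. Then the coefficient `a₁₁` of `F` is `-1`. -/
def IsNormal {R : Type*} [CommRing R] (F : FormalGroup R) : Prop :=
  ∃ inv : PowerSeries R, IsFormalInverse F inv ∧ (PowerSeries.X - 1) * inv = PowerSeries.X

/-! ### The completed polynomial ring -/

/-- The completion of the polynomial ring `R[x_s | s ∈ σ]` at its augmentation ideal (the kernel of
`x_s ↦ 0`, which is the ideal generated by the variables). -/
abbrev CompletedPoly (R σ : Type*) [CommRing R] : Type _ :=
  AdicCompletion (MvPolynomial.idealOfVars σ R) (MvPolynomial σ R)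

/-- The projection of the completion to the `n`-th quotient `R[x_s] / I ^ n`. -/
def CompletedPoly.proj (R σ : Type*) [CommRing R] (n : ℕ) :
    CompletedPoly R σ →ₐ[R] MvPolynomial σ R ⧸ MvPolynomial.idealOfVars σ R ^ n :=
  (AdicCompletion.evalₐ (MvPolynomial.idealOfVars σ R) n).restrictScalars R

/-- The variable `x_s` in the completed polynomial ring. -/
def CompletedPoly.var (R : Type*) {σ : Type*} [CommRing R] (s : σ) : CompletedPoly R σ :=
  AdicCompletion.of (MvPolynomial.idealOfVars σ R) (MvPolynomial σ R) (MvPolynomial.X s)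

theorem idealOfVars_pow_le_comap (R : Type*) {σ τ : Type*} [CommRing R] (f : σ → τ) (n : ℕ) :
    MvPolynomial.idealOfVars σ R ^ n ≤
      (MvPolynomial.idealOfVars τ R ^ n).comap (MvPolynomial.rename (R := R) f) := by
  have h : MvPolynomial.idealOfVars σ R ≤
      (MvPolynomial.idealOfVars τ R).comap (MvPolynomial.rename (R := R) f) := by
    rw [MvPolynomial.idealOfVars, Ideal.span_le]
    rintro _ ⟨s, rfl⟩
    simpa using Ideal.subset_span (Set.mem_range_self (f := MvPolynomial.X (R := R)) (f s))
  exact (Ideal.pow_right_mono h n).trans (Ideal.le_comap_pow _ n)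

/-- The map `R[x_s] / I ^ n → R[x_t] / I ^ n` induced by `x_s ↦ x_(f s)`. -/
def quotRename (R : Type*) {σ τ : Type*} [CommRing R] (f : σ → τ) (n : ℕ) :
    (MvPolynomial σ R ⧸ MvPolynomial.idealOfVars σ R ^ n) →ₐ[R]
      (MvPolynomial τ R ⧸ MvPolynomial.idealOfVars τ R ^ n) :=
  Ideal.quotientMapₐ _ (MvPolynomial.rename f) (idealOfVars_pow_le_comap R f n)

theorem quotRename_compatible (R : Type*) {σ τ : Type*} [CommRing R] (f : σ → τ) {m n : ℕ}
    (hle : m ≤ n) :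
    (Ideal.Quotient.factorₐ R (Ideal.pow_le_pow_right hle)).comp
        ((quotRename R f n).comp (CompletedPoly.proj R σ n)) =
      (quotRename R f m).comp (CompletedPoly.proj R σ m) := by
  ext y
  obtain ⟨q, rfl⟩ := AdicCompletion.mk_surjective _ _ y
  have hq := AdicCompletion.Ideal.mk_eq_mk _ hle q
  simp only [CompletedPoly.proj, AlgHom.comp_apply, AlgHom.restrictScalars_apply,
    AdicCompletion.evalₐ_mk]
  rw [← hq]
  rfl

/-- The continuous extension of `x_s ↦ x_(f s)` to the completed polynomial rings. -/
def CompletedPoly.rename (R : Type*) {σ τ : Type*} [CommRing R] (f : σ → τ) :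
    CompletedPoly R σ →ₐ[R] CompletedPoly R τ :=
  AdicCompletion.liftAlgHom (MvPolynomial.idealOfVars τ R)
    (fun n => (quotRename R f n).comp (CompletedPoly.proj R σ n))
    (fun hle => quotRename_compatible R f hle)

theorem CompletedPoly.proj_rename (R : Type*) {σ τ : Type*} [CommRing R] (f : σ → τ) (n : ℕ)
    (x : CompletedPoly R σ) :
    CompletedPoly.proj R τ n (CompletedPoly.rename R f x) =
      quotRename R f n (CompletedPoly.proj R σ n x) :=
  AdicCompletion.evalₐ_liftAlgHom (MvPolynomial.idealOfVars τ R)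
    (fun n => (quotRename R f n).comp (CompletedPoly.proj R σ n))
    (fun hle => quotRename_compatible R f hle) n x

theorem CompletedPoly.ext_proj {R σ : Type*} [CommRing R] {x y : CompletedPoly R σ}
    (h : ∀ n, CompletedPoly.proj R σ n x = CompletedPoly.proj R σ n y) : x = y :=
  AdicCompletion.ext_evalₐ h

theorem CompletedPoly.rename_var (R : Type*) {σ τ : Type*} [CommRing R] (f : σ → τ) (s : σ) :
    CompletedPoly.rename R f (CompletedPoly.var R s) = CompletedPoly.var R (f s) := by
  refine CompletedPoly.ext_proj fun n => ?_
  rw [CompletedPoly.proj_rename]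
  simp only [CompletedPoly.proj, CompletedPoly.var, AlgHom.restrictScalars_apply,
    AdicCompletion.evalₐ_of]
  exact congrArg (Ideal.Quotient.mk _) (MvPolynomial.rename_X f s)

theorem CompletedPoly.rename_rename (R : Type*) {σ τ υ : Type*} [CommRing R] (f : σ → τ)
    (g : τ → υ) (x : CompletedPoly R σ) :
    CompletedPoly.rename R g (CompletedPoly.rename R f x) =
      CompletedPoly.rename R (fun s => g (f s)) x := by
  refine CompletedPoly.ext_proj fun n => ?_
  simp only [CompletedPoly.proj_rename]
  obtain ⟨p, hp⟩ := Ideal.Quotient.mk_surjective (CompletedPoly.proj R σ n x)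
  rw [← hp]
  refine congrArg (Ideal.Quotient.mk _) ?_
  exact MvPolynomial.rename_rename f g p

theorem CompletedPoly.rename_id (R : Type*) {σ : Type*} [CommRing R] (x : CompletedPoly R σ) :
    CompletedPoly.rename R (fun s => s) x = x := by
  refine CompletedPoly.ext_proj fun n => ?_
  simp only [CompletedPoly.proj_rename]
  obtain ⟨p, hp⟩ := Ideal.Quotient.mk_surjective (CompletedPoly.proj R σ n x)
  rw [← hp]
  refine congrArg (Ideal.Quotient.mk _) ?_
  exact MvPolynomial.rename_id_apply p

/-- Evaluation of a power series in two variables at a pair of variables, `G ↦ G(x_s, x_t)`: a power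
series in finitely many variables is an element of the completed polynomial ring in these
variables. -/
def evalPair {R Λ : Type*} [CommRing R] (s t : Λ) :
    MvPowerSeries (Fin 2) R →ₐ[R] CompletedPoly R Λ :=
  (CompletedPoly.rename R ![s, t]).comp
    ((MvPowerSeries.toAdicCompletion (Fin 2) R).restrictScalars R)

/-! ### The formal group algebra -/

/-- The ideal of the completed polynomial ring generated by `x_0` and by all
`x_(s + t) - F(x_s, x_t)`. -/
def relIdeal {R : Type*} [CommRing R] (F : FormalGroup R) (Λ : Type*) [AddCommGroup Λ] :
    Ideal (CompletedPoly R Λ) :=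
  Ideal.span ({CompletedPoly.var R 0} ∪ Set.range fun p : Λ × Λ =>
    CompletedPoly.var R (p.1 + p.2) - evalPair p.1 p.2 F.toPowerSeries)

/-- The closure of `relIdeal`: the kernels of the projections to `R[x_s] / I ^ n` are a basis of
neighbourhoods of `0` in the completion, so the closure of `J` is the intersection of all
`J + ker`. -/
def closedRelIdeal {R : Type*} [CommRing R] (F : FormalGroup R) (Λ : Type*) [AddCommGroup Λ] :
    Ideal (CompletedPoly R Λ) :=
  ⨅ n : ℕ, relIdeal F Λ ⊔ RingHom.ker (CompletedPoly.proj R Λ n)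

/-- The formal group algebra `R⟦Λ⟧_F`. -/
def FormalGroupAlgebra {R : Type*} [CommRing R] (F : FormalGroup R) (Λ : Type*)
    [AddCommGroup Λ] : Type _ :=
  CompletedPoly R Λ ⧸ closedRelIdeal F Λ

namespace FormalGroupAlgebra

instance {R : Type*} [CommRing R] (F : FormalGroup R) (Λ : Type*) [AddCommGroup Λ] :
    CommRing (FormalGroupAlgebra F Λ) :=
  inferInstanceAs (CommRing (CompletedPoly R Λ ⧸ closedRelIdeal F Λ))

instance {R : Type*} [CommRing R] (F : FormalGroup R) (Λ : Type*) [AddCommGroup Λ] :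
    Algebra R (FormalGroupAlgebra F Λ) :=
  inferInstanceAs (Algebra R (CompletedPoly R Λ ⧸ closedRelIdeal F Λ))

/-- The quotient map from the completed polynomial ring to the formal group algebra. -/
def mk {R : Type*} [CommRing R] (F : FormalGroup R) (Λ : Type*) [AddCommGroup Λ] :
    CompletedPoly R Λ →ₐ[R] FormalGroupAlgebra F Λ :=
  Ideal.Quotient.mkₐ R (closedRelIdeal F Λ)

theorem mk_surjective {R : Type*} [CommRing R] (F : FormalGroup R) (Λ : Type*)
    [AddCommGroup Λ] : Function.Surjective (mk F Λ) :=
  Ideal.Quotient.mk_surjective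

/-- The element `x_s` of the formal group algebra. -/
def x {R : Type*} [CommRing R] (F : FormalGroup R) {Λ : Type*} [AddCommGroup Λ] (s : Λ) :
    FormalGroupAlgebra F Λ :=
  mk F Λ (CompletedPoly.var R s)

theorem closedRelIdeal_le_comap {R : Type*} [CommRing R] (F : FormalGroup R) {Λ Λ' : Type*}
    [AddCommGroup Λ] [AddCommGroup Λ'] (f : Λ →+ Λ') :
    closedRelIdeal F Λ ≤ (closedRelIdeal F Λ').comap (CompletedPoly.rename R f) := by
  have h1 : relIdeal F Λ ≤ (relIdeal F Λ').comap (CompletedPoly.rename R f) := by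
    rw [relIdeal, Ideal.span_le]
    rintro _ (rfl | ⟨p, rfl⟩)
    · refine Ideal.subset_span (Or.inl ?_)
      simp [CompletedPoly.rename_var]
    · refine Ideal.subset_span (Or.inr ⟨(f p.1, f p.2), ?_⟩)
      have h : (fun i => f (![p.1, p.2] i)) = ![f p.1, f p.2] := by
        ext i
        fin_cases i <;> rfl
      simp [CompletedPoly.rename_var, evalPair, CompletedPoly.rename_rename, h]
  intro y hy
  simp only [closedRelIdeal, Ideal.mem_comap, Ideal.mem_iInf] at hy ⊢
  intro n
  obtain ⟨a, ha, b, hb, rfl⟩ := Submodule.mem_sup.mp (hy n)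
  rw [map_add]
  refine Submodule.add_mem_sup (h1 ha) ?_
  rw [RingHom.mem_ker] at hb ⊢
  rw [CompletedPoly.proj_rename, hb, map_zero]

/-- The homomorphism of formal group algebras `x_s ↦ x_(f s)` induced by a homomorphism `f` of
abelian groups. -/
def map {R : Type*} [CommRing R] (F : FormalGroup R) {Λ Λ' : Type*} [AddCommGroup Λ]
    [AddCommGroup Λ'] (f : Λ →+ Λ') : FormalGroupAlgebra F Λ →ₐ[R] FormalGroupAlgebra F Λ' :=
  Ideal.quotientMapₐ _ (CompletedPoly.rename R f) (closedRelIdeal_le_comap F f)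

theorem map_mk {R : Type*} [CommRing R] (F : FormalGroup R) {Λ Λ' : Type*} [AddCommGroup Λ]
    [AddCommGroup Λ'] (f : Λ →+ Λ') (y : CompletedPoly R Λ) :
    map F f (mk F Λ y) = mk F Λ' (CompletedPoly.rename R f y) :=
  rfl

theorem map_x {R : Type*} [CommRing R] (F : FormalGroup R) {Λ Λ' : Type*} [AddCommGroup Λ]
    [AddCommGroup Λ'] (f : Λ →+ Λ') (s : Λ) : map F f (x F s) = x F (f s) := by
  rw [x, map_mk, CompletedPoly.rename_var, x]

/-- The Weyl group acts on the formal group algebra by `w x_s = x_(w s)`. -/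
instance {R : Type*} [CommRing R] (F : FormalGroup R) {ι Λ Λd : Type*} [AddCommGroup Λ]
    [AddCommGroup Λd] (P : RootDatum ι Λ Λd) :
    MulSemiringAction P.weylGroup (FormalGroupAlgebra F Λ) where
  smul w y := map F (DistribSMul.toAddMonoidHom Λ w) y
  one_smul y := by
    obtain ⟨y, rfl⟩ := mk_surjective F Λ y
    change map F (DistribSMul.toAddMonoidHom Λ (1 : P.weylGroup)) _ = _
    rw [map_mk]
    have h : (DistribSMul.toAddMonoidHom Λ (1 : P.weylGroup) : Λ → Λ) = fun s => s := by
      ext s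
      simp
    rw [h, CompletedPoly.rename_id]
  mul_smul w v y := by
    obtain ⟨y, rfl⟩ := mk_surjective F Λ y
    change map F (DistribSMul.toAddMonoidHom Λ (w * v)) _ =
      map F (DistribSMul.toAddMonoidHom Λ w) (map F (DistribSMul.toAddMonoidHom Λ v) _)
    simp only [map_mk, CompletedPoly.rename_rename]
    have h : (DistribSMul.toAddMonoidHom Λ (w * v) : Λ → Λ) = fun s =>
        DistribSMul.toAddMonoidHom Λ w (DistribSMul.toAddMonoidHom Λ v s) := by
      ext s
      simp [mul_smul]
    rw [h]
  smul_zero w := map_zero (map F (DistribSMul.toAddMonoidHom Λ w))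
  smul_add w := map_add (map F (DistribSMul.toAddMonoidHom Λ w))
  smul_one w := map_one (map F (DistribSMul.toAddMonoidHom Λ w))
  smul_mul w := map_mul (map F (DistribSMul.toAddMonoidHom Λ w))

theorem smul_x {R : Type*} [CommRing R] (F : FormalGroup R) {ι Λ Λd : Type*} [AddCommGroup Λ]
    [AddCommGroup Λd] (P : RootDatum ι Λ Λd) (w : P.weylGroup) (s : Λ) :
    w • x F s = x F (w • s) :=
  map_x F (DistribSMul.toAddMonoidHom Λ w) s

theorem smul_algebraMap {R : Type*} [CommRing R] (F : FormalGroup R) {ι Λ Λd : Type*}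
    [AddCommGroup Λ] [AddCommGroup Λd] (P : RootDatum ι Λ Λd) (w : P.weylGroup) (r : R) :
    w • algebraMap R (FormalGroupAlgebra F Λ) r = algebraMap R (FormalGroupAlgebra F Λ) r :=
  (map F (DistribSMul.toAddMonoidHom Λ w)).commutes r

end FormalGroupAlgebra

/-! ### Localization at the roots -/

/-- The multiplicative set generated by the elements `x_α` for all roots `α`. -/
def rootSubmonoid {R : Type*} [CommRing R] (F : FormalGroup R) {ι Λ Λd : Type*}
    [AddCommGroup Λ] [AddCommGroup Λd] (P : RootDatum ι Λ Λd) :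
    Submonoid (FormalGroupAlgebra F Λ) :=
  Submonoid.closure (Set.range fun i => FormalGroupAlgebra.x F (P.root i))

/-- The localization `Q = R⟦Λ⟧_F[1 / x_α | α a root]`. -/
def RootLocalization {R : Type*} [CommRing R] (F : FormalGroup R) {ι Λ Λd : Type*}
    [AddCommGroup Λ] [AddCommGroup Λd] (P : RootDatum ι Λ Λd) : Type _ :=
  Localization (rootSubmonoid F P)

namespace RootLocalization

instance {R : Type*} [CommRing R] (F : FormalGroup R) {ι Λ Λd : Type*}
    [AddCommGroup Λ] [AddCommGroup Λd] (P : RootDatum ι Λ Λd) :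
    CommRing (RootLocalization F P) :=
  inferInstanceAs (CommRing (Localization (rootSubmonoid F P)))

instance {R : Type*} [CommRing R] (F : FormalGroup R) {ι Λ Λd : Type*}
    [AddCommGroup Λ] [AddCommGroup Λd] (P : RootDatum ι Λ Λd) :
    Algebra (FormalGroupAlgebra F Λ) (RootLocalization F P) :=
  inferInstanceAs (Algebra (FormalGroupAlgebra F Λ) (Localization (rootSubmonoid F P)))

instance {R : Type*} [CommRing R] (F : FormalGroup R) {ι Λ Λd : Type*}
    [AddCommGroup Λ] [AddCommGroup Λd] (P : RootDatum ι Λ Λd) :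
    IsLocalization (rootSubmonoid F P) (RootLocalization F P) :=
  inferInstanceAs (IsLocalization (rootSubmonoid F P) (Localization (rootSubmonoid F P)))

instance {R : Type*} [CommRing R] (F : FormalGroup R) {ι Λ Λd : Type*}
    [AddCommGroup Λ] [AddCommGroup Λd] (P : RootDatum ι Λ Λd) :
    Algebra R (RootLocalization F P) :=
  inferInstanceAs (Algebra R (Localization (rootSubmonoid F P)))

instance {R : Type*} [CommRing R] (F : FormalGroup R) {ι Λ Λd : Type*}
    [AddCommGroup Λ] [AddCommGroup Λd] (P : RootDatum ι Λ Λd) :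
    IsScalarTower R (FormalGroupAlgebra F Λ) (RootLocalization F P) :=
  inferInstanceAs (IsScalarTower R (FormalGroupAlgebra F Λ) (Localization (rootSubmonoid F P)))

theorem rootSubmonoid_le_comap {R : Type*} [CommRing R] (F : FormalGroup R) {ι Λ Λd : Type*}
    [AddCommGroup Λ] [AddCommGroup Λd] (P : RootDatum ι Λ Λd) (w : P.weylGroup) :
    rootSubmonoid F P ≤ (rootSubmonoid F P).comap
      (MulSemiringAction.toRingHom P.weylGroup (FormalGroupAlgebra F Λ) w) := by
  rw [rootSubmonoid, Submonoid.closure_le]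
  rintro _ ⟨i, rfl⟩
  refine Submonoid.subset_closure ⟨P.weylGroupToPerm w i, ?_⟩
  change FormalGroupAlgebra.x F (P.root (P.weylGroupToPerm w i)) =
    w • FormalGroupAlgebra.x F (P.root i)
  rw [FormalGroupAlgebra.smul_x, P.weylGroup_apply_root]

/-- The action of a Weyl group element on the localization, extending the one on `R⟦Λ⟧_F`. -/
def weylMap {R : Type*} [CommRing R] (F : FormalGroup R) {ι Λ Λd : Type*}
    [AddCommGroup Λ] [AddCommGroup Λd] (P : RootDatum ι Λ Λd) (w : P.weylGroup) :
    RootLocalization F P →+* RootLocalization F P :=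
  IsLocalization.map (RootLocalization F P)
    (MulSemiringAction.toRingHom P.weylGroup (FormalGroupAlgebra F Λ) w)
    (rootSubmonoid_le_comap F P w)

theorem weylMap_algebraMap {R : Type*} [CommRing R] (F : FormalGroup R) {ι Λ Λd : Type*}
    [AddCommGroup Λ] [AddCommGroup Λd] (P : RootDatum ι Λ Λd) (w : P.weylGroup)
    (y : FormalGroupAlgebra F Λ) :
    weylMap F P w (algebraMap _ (RootLocalization F P) y) = algebraMap _ _ (w • y) :=
  IsLocalization.map_eq (rootSubmonoid_le_comap F P w) y

/-- The action of the Weyl group on the localization. -/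
instance {R : Type*} [CommRing R] (F : FormalGroup R) {ι Λ Λd : Type*}
    [AddCommGroup Λ] [AddCommGroup Λd] (P : RootDatum ι Λ Λd) :
    MulSemiringAction P.weylGroup (RootLocalization F P) where
  smul w q := weylMap F P w q
  one_smul q := by
    have h : weylMap F P 1 = RingHom.id _ := by
      refine IsLocalization.ringHom_ext (rootSubmonoid F P) (RingHom.ext fun y => ?_)
      simp [weylMap_algebraMap]
    exact congrArg (fun f : RootLocalization F P →+* RootLocalization F P => f q) h
  mul_smul w v q := by
    have h : weylMap F P (w * v) = (weylMap F P w).comp (weylMap F P v) := by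
      refine IsLocalization.ringHom_ext (rootSubmonoid F P) (RingHom.ext fun y => ?_)
      simp [weylMap_algebraMap, mul_smul]
    exact congrArg (fun f : RootLocalization F P →+* RootLocalization F P => f q) h
  smul_zero w := map_zero (weylMap F P w)
  smul_add w := map_add (weylMap F P w)
  smul_one w := map_one (weylMap F P w)
  smul_mul w := map_mul (weylMap F P w)

theorem smul_algebraMap {R : Type*} [CommRing R] (F : FormalGroup R) {ι Λ Λd : Type*}
    [AddCommGroup Λ] [AddCommGroup Λd] (P : RootDatum ι Λ Λd) (w : P.weylGroup)
    (y : FormalGroupAlgebra F Λ) :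
    w • algebraMap _ (RootLocalization F P) y = algebraMap _ (RootLocalization F P) (w • y) :=
  weylMap_algebraMap F P w y

instance {R : Type*} [CommRing R] (F : FormalGroup R) {ι Λ Λd : Type*}
    [AddCommGroup Λ] [AddCommGroup Λd] (P : RootDatum ι Λ Λd) :
    SMulCommClass P.weylGroup R (RootLocalization F P) where
  smul_comm w r q := by
    rw [Algebra.smul_def, Algebra.smul_def, smul_mul',
      IsScalarTower.algebraMap_apply R (FormalGroupAlgebra F Λ) (RootLocalization F P),
      smul_algebraMap F P w, FormalGroupAlgebra.smul_algebraMap F P w r]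

/-- The inverse `1 / x_s` in the localization, for a root `s`. (By convention it is `0` if `x_s` is
not invertible; it is only used at roots.) -/
def xInv {R : Type*} [CommRing R] (F : FormalGroup R) {ι Λ Λd : Type*}
    [AddCommGroup Λ] [AddCommGroup Λd] (P : RootDatum ι Λ Λd) (s : Λ) : RootLocalization F P :=
  Ring.inverse (algebraMap (FormalGroupAlgebra F Λ) (RootLocalization F P)
    (FormalGroupAlgebra.x F s))

/-- The coefficient
`κ_(s,t) = 1 / (x_(s+t) x_t) - 1 / (x_(s+t) x_(-s)) - 1 / (x_s x_t)`,
for roots `s`, `t` whose sum is a root. One writes `κ_ij` for `(s, t) = (α_i, α_j)` and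
`κ_(j,i+j)` for `(s, t) = (α_j, α_i + α_j)`. -/
def kappa {R : Type*} [CommRing R] (F : FormalGroup R) {ι Λ Λd : Type*}
    [AddCommGroup Λ] [AddCommGroup Λd] (P : RootDatum ι Λ Λd) (s t : Λ) : RootLocalization F P :=
  xInv F P (s + t) * xInv F P t - xInv F P (s + t) * xInv F P (-s) - xInv F P s * xInv F P t

end RootLocalization

/-! ### The formal affine Demazure algebra -/

/-- The twisted formal group algebra `Q_W`: the free left `Q`-module with basis `δ_w`, `w ∈ W`, and
the multiplication `q δ_w * q' δ_w' = q w(q') δ_(w w')`. The element `q δ_w` is `single w q`. -/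
abbrev TwistedAlgebra {R : Type*} [CommRing R] (F : FormalGroup R) {ι Λ Λd : Type*}
    [AddCommGroup Λ] [AddCommGroup Λd] (P : RootDatum ι Λ Λd) : Type _ :=
  SkewMonoidAlgebra (RootLocalization F P) P.weylGroup

/-- The embedding `q ↦ q δ_e` of `Q` into `Q_W`. -/
def coeffHom {R : Type*} [CommRing R] (F : FormalGroup R) {ι Λ Λd : Type*}
    [AddCommGroup Λ] [AddCommGroup Λd] (P : RootDatum ι Λ Λd) :
    RootLocalization F P →+* TwistedAlgebra F P :=
  SkewMonoidAlgebra.singleOneRingHom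

/-- The Demazure element `X_α = (1 / x_α) (1 - δ_(s_α))` for the root `α` with index `i`. -/
def demazureElement {R : Type*} [CommRing R] (F : FormalGroup R) {ι Λ Λd : Type*}
    [AddCommGroup Λ] [AddCommGroup Λd] (P : RootDatum ι Λ Λd) (i : ι) : TwistedAlgebra F P :=
  coeffHom F P (RootLocalization.xInv F P (P.root i)) *
    (1 - SkewMonoidAlgebra.of (RootLocalization F P) P.weylGroup
      (RootPairing.weylGroup.ofIdx P i))

/-- The formal affine Demazure algebra: the `R`-subalgebra of `Q_W` generated by `R⟦Λ⟧_F` and the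
elements `X_α` for all roots `α`. -/
def DemazureAlgebra {R : Type*} [CommRing R] (F : FormalGroup R) {ι Λ Λd : Type*}
    [AddCommGroup Λ] [AddCommGroup Λd] (P : RootDatum ι Λ Λd) :
    Subalgebra R (TwistedAlgebra F P) :=
  Algebra.adjoin R
    ((Set.range fun y : FormalGroupAlgebra F Λ => coeffHom F P (algebraMap _ _ y)) ∪
      Set.range (demazureElement F P))

namespace DemazureAlgebra

/-- `X_α` as an element of the formal affine Demazure algebra. -/
def X {R : Type*} [CommRing R] (F : FormalGroup R) {ι Λ Λd : Type*}
    [AddCommGroup Λ] [AddCommGroup Λd] (P : RootDatum ι Λ Λd) (i : ι) : DemazureAlgebra F P :=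
  ⟨demazureElement F P i, Algebra.subset_adjoin (Or.inr ⟨i, rfl⟩)⟩

/-- An element of `R⟦Λ⟧_F` as an element of the formal affine Demazure algebra. -/
def C {R : Type*} [CommRing R] (F : FormalGroup R) {ι Λ Λd : Type*}
    [AddCommGroup Λ] [AddCommGroup Λd] (P : RootDatum ι Λ Λd) (y : FormalGroupAlgebra F Λ) :
    DemazureAlgebra F P :=
  ⟨coeffHom F P (algebraMap _ _ y), Algebra.subset_adjoin (Or.inl ⟨y, rfl⟩)⟩

end DemazureAlgebra

end FormalDemazure

end

/-!
The argument rests on one divisibility. In `R⟦x, y⟧` the power series `x + y - x y - F(x, y)` is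
divisible by `x y F(x, y)`. It vanishes for `x = 0` and for `y = 0`, so it is `x y G`. Normality
says that the inverse `ı(x)` of `x` satisfies `x + ı(x) = x ı(x)`, so `x y G` vanishes on the curve
`y = ı(x)`, and so does `G` since `ı(x)` is `x` up to a unit. The substitution `y ↦ F(x, y)` is
invertible and carries the line `y = 0` to the curve `F(x, y) = 0`; hence `F` divides `G`
(`IsNormal.exists_add_sub_mul_sub_eq`).

Evaluating at `x_s`, `x_t` gives `x_s + x_t - x_s x_t - x_(s+t) = x_s x_t x_(s+t) h` in the formal
group algebra. For `t = -s` this becomes `1 / x_s + 1 / x_(-s) = 1` in the localization, and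
with that relation `h` maps to `κ_(s,t)`, which is thus integral. Writing `a`, `b`, `c`, `d` for the
inverses of `x` at `α_i`, `α_j`, `α_i + α_j`, `α_i + 2 α_j`, the simple reflections permute these
elements up to `q ↦ 1 - q`, so that invariance of the coefficients is a polynomial identity. The
relations between the `X_i` are identities in any skew group algebra over a commutative ring with
such elements (`single_sub_single_sq`, `demazure_braid_three`, `demazure_braid_four`): compare the
coefficients of the group elements. The orders of `s_i s_j` come from the faithful action of the
Weyl group on the lattice, and the passage from the localization back to the formal group algebra is
injective because the `x_α` are non-zero-divisors.
-/

namespace FormalDemazure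

/-! ### The divisibility in two variables -/

section

open MvPowerSeries

theorem X_dvd_of_subst_update_eq_zero {R σ : Type*} [CommRing R] [Finite σ] [DecidableEq σ] (s : σ)
    (f : MvPowerSeries σ R)
    (h : f.subst (Function.update (X : σ → MvPowerSeries σ R) s 0) = 0) : X s ∣ f := by
  rw [X_dvd_iff]
  intro m hm
  have ha : HasSubst (Function.update (X : σ → MvPowerSeries σ R) s 0) :=
    hasSubst_of_constantCoeff_zero fun t => by
      by_cases ht : t = s
      · subst ht; simp
      · simp [ht]
  have h1 := congrArg (coeff m) h
  have key (d : σ →₀ ℕ) (hd : d s = 0) :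
      (d.prod fun t e => Function.update (X : σ → MvPowerSeries σ R) s 0 t ^ e) =
        monomial d 1 := by
    rw [monomial_one_eq]
    refine Finsupp.prod_congr fun t ht => ?_
    have : t ≠ s := by rintro rfl; simp_all
    simp [this]
  rw [coeff_subst ha, finsum_eq_single _ m] at h1
  · simpa [key m hm] using h1
  · intro d hd
    by_cases hs : d s = 0
    · rw [key d hs, coeff_monomial_ne hd.symm, smul_zero]
    · have : (d.prod fun t e => Function.update (X : σ → MvPowerSeries σ R) s 0 t ^ e) = 0 :=
        Finset.prod_eq_zero (Finsupp.mem_support_iff.mpr hs) (by simp [hs])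
      rw [this, map_zero, smul_zero]

/-- A power series in two variables that vanishes on both axes is divisible by the product of the
variables. -/
theorem X_zero_mul_X_one_dvd {R : Type*} [CommRing R] (f : MvPowerSeries (Fin 2) R)
    (h0 : f.subst ![0, X (R := R) (1 : Fin 2)] = 0)
    (h1 : f.subst ![X (R := R) (0 : Fin 2), 0] = 0) :
    X 0 * X 1 ∣ f := by
  have e0 : ![0, X (R := R) (1 : Fin 2)] = Function.update X 0 0 := by
    ext1 i; fin_cases i <;> rfl
  have e1 : ![X (R := R) (0 : Fin 2), 0] = Function.update X 1 0 := by
    ext1 i; fin_cases i <;> rfl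
  rw [e1] at h1
  obtain ⟨g, rfl⟩ := X_dvd_of_subst_update_eq_zero 1 f h1
  rw [subst_mul HasSubst.zero_X, subst_X HasSubst.zero_X] at h0
  have h2 : g.subst ![0, X (R := R) (1 : Fin 2)] = 0 :=
    X_mem_nonzeroDivisors.1 _ h0
  rw [e0] at h2
  obtain ⟨k, rfl⟩ := X_dvd_of_subst_update_eq_zero 0 g h2
  exact ⟨k, by ring⟩

/-- The divisibility from which the integrality of the coefficients `κ` follows. The quotient of the
left-hand side by `X 0 * X 1` vanishes on the curve `F = 0`, and the invertible substitution
`X 1 ↦ F(X 0, X 1)` turns this curve into the line `X 1 = 0`. -/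
theorem IsNormal.exists_add_sub_mul_sub_eq {R : Type*} [CommRing R] {F : FormalGroup R} [F.IsComm]
    (hF : IsNormal F) :
    ∃ H : MvPowerSeries (Fin 2) R,
      X 0 + X 1 - X 0 * X 1 - F.toPowerSeries = X 0 * X 1 * F.toPowerSeries * H := by
  obtain ⟨inv, hinv, hx⟩ := hF
  have hX (i : Fin 2) : PowerSeries.HasSubst (X i : MvPowerSeries (Fin 2) R) :=
    PowerSeries.HasSubst.X i
  -- `y` is the formal inverse of `X 0`
  set y : MvPowerSeries (Fin 2) R := inv.subst (X 0) with hy_def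
  have hy0 : constantCoeff y = 0 :=
    PowerSeries.constantCoeff_subst_eq_zero (by simp) _ hinv.constantCoeff_eq_zero
  have hy : PowerSeries.HasSubst y := PowerSeries.HasSubst.of_constantCoeff_zero hy0
  have hyx : (X 0 - 1) * y = X 0 := by
    have h1 : (1 : PowerSeries R).subst (X 0 : MvPowerSeries (Fin 2) R) = 1 := by
      rw [← PowerSeries.coe_substAlgHom (hX 0), map_one]
    have := congrArg (PowerSeries.subst (X 0 : MvPowerSeries (Fin 2) R)) hx
    rwa [PowerSeries.subst_mul (hX 0), PowerSeries.subst_sub (hX 0), PowerSeries.subst_X (hX 0),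
      h1] at this
  have hFy : F.toPowerSeries.subst ![X 0, y] = (0 : MvPowerSeries (Fin 2) R) := by
    have hs : HasSubst ![(PowerSeries.X : PowerSeries R), inv] :=
      hasSubst_of_constantCoeff_zero fun i => by
        fin_cases i
        · exact PowerSeries.constantCoeff_X
        · exact hinv.constantCoeff_eq_zero
    have := congrArg (PowerSeries.subst (X 0 : MvPowerSeries (Fin 2) R)) hinv.subst_eq_zero
    rw [PowerSeries.subst, subst_comp_subst_apply hs (hX 0).const] at this
    rw [← PowerSeries.coe_substAlgHom (hX 0), map_zero] at this
    rw [← this]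
    congr! 2 with i
    fin_cases i
    · exact (PowerSeries.subst_X (hX 0)).symm
    · rfl
  have hyF : F.toPowerSeries.subst ![y, X 0] = (0 : MvPowerSeries (Fin 2) R) := by
    rw [F.comm' hy (hX 0), hFy]
  have hFF : F.toPowerSeries.subst ![X 0, X 1] = F.toPowerSeries := by
    have : ![X 0, X 1] = (X : Fin 2 → MvPowerSeries (Fin 2) R) := by
      ext1 i; fin_cases i <;> rfl
    rw [this, subst_self, id]
  have sub2 {f g : MvPowerSeries (Fin 2) R} (hf : constantCoeff f = 0)
      (hg : constantCoeff g = 0) : HasSubst ![f, g] :=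
    hasSubst_of_constantCoeff_zero fun i => by fin_cases i <;> assumption
  have c0 : constantCoeff (X 0 : MvPowerSeries (Fin 2) R) = 0 := constantCoeff_X 0
  have c1 : constantCoeff (X 1 : MvPowerSeries (Fin 2) R) = 0 := constantCoeff_X 1
  have hs0 := sub2 c0 hy0
  have hsF := sub2 c0 F.zero_constantCoeff
  have hyX := sub2 hy0 c1
  -- `X 1 ↦ z = F(y, X 1)` is the substitution inverse to `X 1 ↦ F(X 0, X 1)`
  set z : MvPowerSeries (Fin 2) R := F.toPowerSeries.subst ![y, X 1] with hz_def
  have hz0 : constantCoeff z = 0 :=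
    constantCoeff_subst_eq_zero hyX (by intro i; fin_cases i <;> assumption) F.zero_constantCoeff
  have hsz := sub2 c0 hz0
  obtain ⟨G, hG⟩ : X 0 * X 1 ∣ X 0 + X 1 - X 0 * X 1 - F.toPowerSeries := by
    refine X_zero_mul_X_one_dvd _ ?_ ?_
    · have hs : HasSubst ![0, X (R := R) (1 : Fin 2)] := HasSubst.zero_X
      simp [subst_sub hs, subst_add hs, subst_mul hs, subst_X hs, F.zero_add (hX 1)]
    · have hs : HasSubst ![X (R := R) (0 : Fin 2), 0] := HasSubst.X_zero
      simp [subst_sub hs, subst_add hs, subst_mul hs, subst_X hs, F.add_zero (hX 0)]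
  have hGy : G.subst ![X 0, y] = (0 : MvPowerSeries (Fin 2) R) := by
    have h := congrArg (subst ![X 0, y]) hG
    simp only [subst_sub hs0, subst_add hs0, subst_mul hs0, subst_X hs0, hFy,
      Matrix.cons_val_zero, Matrix.cons_val_one] at h
    -- `X 0 * y * G(X 0, y) = 0`, and `X 0 = (X 0 - 1) * y` trades the factor `y` for `X 0`
    have h3 : G.subst ![X 0, y] * X 0 * X 0 * X 0 = (0 : MvPowerSeries (Fin 2) R) := by
      linear_combination (-(G.subst ![X 0, y] * X 0 * X 0) : MvPowerSeries (Fin 2) R) * hyx -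
        ((X 0 : MvPowerSeries (Fin 2) R) - 1) * X 0 * h -
        ((X 0 : MvPowerSeries (Fin 2) R) - 1) * X 0 * hyx
    exact X_mem_nonzeroDivisors.2 _ (X_mem_nonzeroDivisors.2 _ (X_mem_nonzeroDivisors.2 _ h3))
  obtain ⟨K, hK⟩ : X 1 ∣ G.subst ![X 0, z] := by
    apply X_dvd_of_subst_update_eq_zero
    have e1 : Function.update X 1 0 = ![X (R := R) (0 : Fin 2), 0] := by
      ext1 i; fin_cases i <;> rfl
    have hs : HasSubst ![X (R := R) (0 : Fin 2), 0] := HasSubst.X_zero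
    rw [e1, subst_comp_subst_apply hsz hs]
    refine Eq.trans ?_ hGy
    congr! 2 with i
    fin_cases i
    · simp [subst_X hs]
    · change subst _ z = y
      rw [hz_def, subst_comp_subst_apply hyX hs]
      conv_rhs => rw [← F.add_zero hy]
      congr! 2 with i
      fin_cases i
      · change subst _ y = y
        rw [hy_def, PowerSeries.subst, subst_comp_subst_apply (hX 0).const hs]
        simp [subst_X hs]
      · simp [subst_X hs]
  refine ⟨K.subst ![X 0, F.toPowerSeries], ?_⟩
  have hGK : G = F.toPowerSeries * K.subst ![X 0, F.toPowerSeries] := by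
    have h := congrArg (subst ![X 0, F.toPowerSeries]) hK
    rw [subst_mul hsF, subst_X hsF, subst_comp_subst_apply hsz hsF] at h
    have e : (fun i => subst ![X 0, F.toPowerSeries] (![X 0, z] i)) =
        (X : Fin 2 → MvPowerSeries (Fin 2) R) := by
      ext1 i
      fin_cases i
      · simp [subst_X hsF]
      · change subst _ z = X 1
        have e2 : (fun i => subst ![X 0, F.toPowerSeries] (![y, X 1] i)) =
            ![y, F.toPowerSeries.subst ![X 0, X 1]] := by
          ext1 i
          fin_cases i
          · change subst _ y = y
            rw [hy_def, PowerSeries.subst, subst_comp_subst_apply (hX 0).const hsF]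
            simp [subst_X hsF]
          · simp [subst_X hsF, hFF]
        rw [hz_def, subst_comp_subst_apply hyX hsF, e2, ← F.assoc' hy (hX 0) (hX 1), hyF,
          F.zero_add (hX 1)]
    rw [e, subst_self] at h
    simpa using h
  rw [hG]
  nth_rw 1 [hGK]
  ring

end

/-! ### Relations in skew group algebras -/

section

open SkewMonoidAlgebra

variable {K G : Type*} [CommRing K] [Group G] [MulSemiringAction G K]

theorem single_sub_single_sq (a : K) (s : G) (hs : s * s = 1)
    (hsa : s • a = 1 - a) :
    (single 1 a - single s a : SkewMonoidAlgebra K G) ^ 2 = single 1 a - single s a := by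
  -- as elements of the free left module, so that `module` can compare coefficients
  have e (g : G) (r : K) : (single g r : SkewMonoidAlgebra K G) = r • single g 1 := by
    rw [smul_single, smul_eq_mul, mul_one]
  simp only [sq, sub_mul, mul_sub, single_mul_single, one_smul, one_mul, mul_one, hsa, hs]
  simp only [e _ a, e _ (_ * _), e _ (_ - _)]
  module

/-- The relation between `X = a (1 - s)` and `Y = b (1 - t)` when `s` and `t` generate a quotient of
the dihedral group of order six and act on `a`, `b`, `c` as the simple reflections of `A₂` act on
the inverses of `x_α`, `x_β`, `x_(α+β)`. -/
theorem demazure_braid_three (a b c : K) (s t : G) (hs : s * s = 1) (ht : t * t = 1)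
    (hst : s * t * s = t * s * t) (hsa : s • a = 1 - a) (hsb : s • b = c) (hsc : s • c = b)
    (hta : t • a = c) (htb : t • b = 1 - b) (htc : t • c = a) :
    (single 1 b - single t b) * (single 1 a - single s a) * (single 1 b - single t b) -
      (single 1 a - single s a) * (single 1 b - single t b) * (single 1 a - single s a) =
    ((single 1 a - single s a) - (single 1 b - single t b)) *
      (single 1 (c * (a + b - 1) - a * b) : SkewMonoidAlgebra K G) := by
  -- as elements of the free left module, so that `module` can compare coefficients
  have e (g : G) (r : K) : (single g r : SkewMonoidAlgebra K G) = r • single g 1 := by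
    rw [smul_single, smul_eq_mul, mul_one]
  simp only [sub_mul, mul_sub, single_mul_single, one_smul, one_mul, mul_one, hsa, hs, hsb, hsc,
    hta, htb, htc, ht, smul_sub, smul_add, smul_mul', mul_smul, hst]
  simp only [e _ (_ * _), e _ (_ - _)]
  module

/-- The relation between `X = a (1 - s)` and `Y = b (1 - t)` when `s` and `t` generate a quotient of
the dihedral group of order eight and act on `a`, `b`, `c`, `d` as the simple reflections of `B₂`,
with `α` long and `β` short, act on the inverses of `x_α`, `x_β`, `x_(α+β)`, `x_(α+2β)`. -/
theorem demazure_braid_four (a b c d : K) (s t : G) (hs : s * s = 1) (ht : t * t = 1)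
    (hst : s * t * s * t = t * s * t * s) (hsa : s • a = 1 - a) (hsb : s • b = c)
    (hsc : s • c = b) (hsd : s • d = d) (hta : t • a = d) (htb : t • b = 1 - b) (htc : t • c = c)
    (htd : t • d = a) :
    (single 1 b - single t b) * (single 1 a - single s a) * (single 1 b - single t b) *
        (single 1 a - single s a) -
      (single 1 a - single s a) * (single 1 b - single t b) * (single 1 a - single s a) *
        (single 1 b - single t b) =
    ((single 1 a - single s a) * (single 1 b - single t b) -
        (single 1 b - single t b) * (single 1 a - single s a)) *
      (single 1 (c * (a + b - 1) - a * b + (d * (b + c - 1) - b * c)) :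
        SkewMonoidAlgebra K G) := by
  -- as elements of the free left module, so that `module` can compare coefficients
  have e (g : G) (r : K) : (single g r : SkewMonoidAlgebra K G) = r • single g 1 := by
    rw [smul_single, smul_eq_mul, mul_one]
  have hss (g : G) : g * s * s = g := by rw [mul_assoc, hs, mul_one]
  have htt (g : G) : g * t * t = g := by rw [mul_assoc, ht, mul_one]
  simp only [sub_mul, mul_sub, single_mul_single, one_smul, one_mul, mul_one, hsa, hs, hsb, hsc,
    hsd, htd, hss, htt, hta, htb, htc, ht, smul_sub, smul_add, smul_mul', smul_one, mul_smul, hst]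
  simp only [e _ (_ * _), e _ (_ - _)]
  module

end

/-! ### Relations in the Weyl group -/

section

open RootPairing

variable {ι Λ Λd : Type*} [AddCommGroup Λ] [AddCommGroup Λd] (P : RootDatum ι Λ Λd)

theorem weylGroup_eq_of_forall_smul_eq {g h : P.weylGroup} (H : ∀ v : Λ, g • v = h • v) :
    g = h := by
  refine Subtype.ext (Equiv.weightHom_injective P ?_)
  ext v
  exact H v

theorem weylGroup_ofIdx_smul_apply (i : ι) (v : Λ) :
    weylGroup.ofIdx P i • v = v - P.toLinearMap v (P.coroot i) • P.root i := by
  rw [weylGroup.ofIdx_smul, Equiv.reflection_smul, reflection_apply]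
  rfl

theorem weylGroup_ofIdx_smul_root (i j : ι) :
    weylGroup.ofIdx P i • P.root j = P.root j - P.pairing j i • P.root i := by
  rw [weylGroup_ofIdx_smul_apply]; rfl

theorem weylGroup_ofIdx_mul_self (i : ι) :
    weylGroup.ofIdx P i * weylGroup.ofIdx P i = 1 := by
  refine weylGroup_eq_of_forall_smul_eq P fun v => ?_
  simp [mul_smul]

theorem weylGroup_braid_three {i j : ι} (hji : P.pairing j i = -1) (hij : P.pairing i j = -1) :
    weylGroup.ofIdx P i * weylGroup.ofIdx P j * weylGroup.ofIdx P i =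
      weylGroup.ofIdx P j * weylGroup.ofIdx P i * weylGroup.ofIdx P j := by
  refine weylGroup_eq_of_forall_smul_eq P fun v => ?_
  have h1 : P.toLinearMap (P.root j) (P.coroot i) = -1 := hji
  have h2 : P.toLinearMap (P.root i) (P.coroot j) = -1 := hij
  simp only [mul_smul, weylGroup_ofIdx_smul_apply, map_sub, map_smul, LinearMap.sub_apply,
    LinearMap.smul_apply, h1, h2, root_coroot_two, smul_eq_mul]
  module

theorem weylGroup_braid_four {i j : ι} (hji : P.pairing j i = -1) (hij : P.pairing i j = -2) :
    weylGroup.ofIdx P i * weylGroup.ofIdx P j * weylGroup.ofIdx P i * weylGroup.ofIdx P j =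
      weylGroup.ofIdx P j * weylGroup.ofIdx P i * weylGroup.ofIdx P j * weylGroup.ofIdx P i := by
  refine weylGroup_eq_of_forall_smul_eq P fun v => ?_
  have h1 : P.toLinearMap (P.root j) (P.coroot i) = -1 := hji
  have h2 : P.toLinearMap (P.root i) (P.coroot j) = -2 := hij
  simp only [mul_smul, weylGroup_ofIdx_smul_apply, map_sub, map_smul, LinearMap.sub_apply,
    LinearMap.smul_apply, h1, h2, root_coroot_two, smul_eq_mul]
  module

theorem orderOf_ofIdx_mul_ofIdx_eq_three {i j : ι} (hji : P.pairing j i = -1)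
    (hij : P.pairing i j = -1) :
    orderOf (weylGroup.ofIdx P i * weylGroup.ofIdx P j) = 3 := by
  have : Fact (Nat.Prime 3) := ⟨Nat.prime_three⟩
  have hi := weylGroup_ofIdx_mul_self P i
  have hj := weylGroup_ofIdx_mul_self P j
  have hb := weylGroup_braid_three P hji hij
  refine orderOf_eq_prime ?_ fun h => ?_
  · calc (weylGroup.ofIdx P i * weylGroup.ofIdx P j) ^ 3
      _ = weylGroup.ofIdx P i * weylGroup.ofIdx P j * weylGroup.ofIdx P i *
          (weylGroup.ofIdx P j * weylGroup.ofIdx P i * weylGroup.ofIdx P j) := by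
        simp only [pow_succ, pow_zero, one_mul, mul_assoc]
      _ = 1 := by
        nth_rw 1 [hb]
        rw [mul_eq_one_iff_eq_inv]
        simp only [mul_inv_rev, inv_eq_of_mul_eq_one_right hi, inv_eq_of_mul_eq_one_right hj,
          mul_assoc]
  -- pairing the image of `α_j` with `α_j^∨` tells the element from `1`
  · have h1 := congrArg (fun g => P.toLinearMap (g • P.root j) (P.coroot j)) h
    have e1 : P.toLinearMap (P.root j) (P.coroot i) = -1 := hji
    have e2 : P.toLinearMap (P.root i) (P.coroot j) = -1 := hij
    simp only [mul_smul, weylGroup_ofIdx_smul_apply, map_sub, map_smul, LinearMap.sub_apply,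
      LinearMap.smul_apply, e1, e2, root_coroot_two, smul_eq_mul, one_smul] at h1
    norm_num at h1

theorem orderOf_ofIdx_mul_ofIdx_eq_four {i j : ι} (hji : P.pairing j i = -1)
    (hij : P.pairing i j = -2) :
    orderOf (weylGroup.ofIdx P i * weylGroup.ofIdx P j) = 4 := by
  have : Fact (Nat.Prime 2) := ⟨Nat.prime_two⟩
  have hi := weylGroup_ofIdx_mul_self P i
  have hj := weylGroup_ofIdx_mul_self P j
  have hb := weylGroup_braid_four P hji hij
  refine orderOf_eq_prime_pow (p := 2) (n := 1) (fun h => ?_) ?_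
  -- pairing the image of `α_j` with `α_j^∨` tells the element from `1`
  · have h1 := congrArg (fun g => P.toLinearMap (g • P.root j) (P.coroot j)) h
    have e1 : P.toLinearMap (P.root j) (P.coroot i) = -1 := hji
    have e2 : P.toLinearMap (P.root i) (P.coroot j) = -2 := hij
    simp only [pow_one, sq, mul_smul, weylGroup_ofIdx_smul_apply, map_sub, map_smul,
      LinearMap.sub_apply, LinearMap.smul_apply, e1, e2, root_coroot_two, smul_eq_mul,
      one_smul] at h1
    norm_num at h1
  · calc (weylGroup.ofIdx P i * weylGroup.ofIdx P j) ^ 2 ^ (1 + 1)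
      _ = weylGroup.ofIdx P i * weylGroup.ofIdx P j * weylGroup.ofIdx P i * weylGroup.ofIdx P j *
          (weylGroup.ofIdx P i * weylGroup.ofIdx P j * weylGroup.ofIdx P i *
            weylGroup.ofIdx P j) := by
        norm_num [pow_succ, mul_assoc]
      _ = 1 := by
        nth_rw 1 [hb]
        rw [mul_eq_one_iff_eq_inv]
        simp only [mul_inv_rev, inv_eq_of_mul_eq_one_right hi, inv_eq_of_mul_eq_one_right hj,
          mul_assoc]

end

/-! ### Consequences in the formal group algebra -/

theorem evalPair_X_zero {R Λ : Type*} [CommRing R] (s t : Λ) :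
    evalPair s t (MvPowerSeries.X 0 : MvPowerSeries (Fin 2) R) = CompletedPoly.var R s := by
  have h := MvPowerSeries.toAdicCompletion_coe (R := R) (MvPolynomial.X (0 : Fin 2))
  rw [MvPolynomial.coe_X] at h
  change CompletedPoly.rename R ![s, t] (MvPowerSeries.toAdicCompletion (Fin 2) R _) = _
  rw [h]
  exact CompletedPoly.rename_var R ![s, t] 0

theorem evalPair_X_one {R Λ : Type*} [CommRing R] (s t : Λ) :
    evalPair s t (MvPowerSeries.X 1 : MvPowerSeries (Fin 2) R) = CompletedPoly.var R t := by
  have h := MvPowerSeries.toAdicCompletion_coe (R := R) (MvPolynomial.X (1 : Fin 2))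
  rw [MvPolynomial.coe_X] at h
  change CompletedPoly.rename R ![s, t] (MvPowerSeries.toAdicCompletion (Fin 2) R _) = _
  rw [h]
  exact CompletedPoly.rename_var R ![s, t] 1

namespace FormalGroupAlgebra

variable {R : Type*} [CommRing R] (F : FormalGroup R) {Λ : Type*} [AddCommGroup Λ]

theorem mk_eq_zero_of_mem_relIdeal {y : CompletedPoly R Λ} (hy : y ∈ relIdeal F Λ) :
    mk F Λ y = 0 :=
  Ideal.Quotient.eq_zero_iff_mem.mpr
    ((le_iInf fun _ => le_sup_left : relIdeal F Λ ≤ closedRelIdeal F Λ) hy)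

theorem x_zero : x F (0 : Λ) = 0 :=
  mk_eq_zero_of_mem_relIdeal F (Ideal.subset_span (Or.inl rfl))

theorem mk_evalPair (s t : Λ) : mk F Λ (evalPair s t F.toPowerSeries) = x F (s + t) := by
  have h := mk_eq_zero_of_mem_relIdeal F (Ideal.subset_span (Or.inr ⟨(s, t), rfl⟩))
  rw [map_sub, sub_eq_zero] at h
  exact h.symm

variable {F} [F.IsComm]

theorem exists_add_sub_mul_sub_eq (hF : IsNormal F) (s t : Λ) :
    ∃ h : FormalGroupAlgebra F Λ,
      x F s + x F t - x F s * x F t - x F (s + t) = x F s * x F t * x F (s + t) * h := by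
  obtain ⟨H, hH⟩ := hF.exists_add_sub_mul_sub_eq
  refine ⟨mk F Λ (evalPair s t H), ?_⟩
  have h := congrArg (fun f => mk F Λ (evalPair s t f)) hH
  simp only [map_sub, map_add, map_mul, evalPair_X_zero, evalPair_X_one, mk_evalPair] at h
  exact h

/-- The formal inverse of a normal formal group law is `x / (x - 1)`, here with the denominator
cleared. -/
theorem x_add_x_neg (hF : IsNormal F) (s : Λ) : x F s + x F (-s) = x F s * x F (-s) := by
  obtain ⟨h, hh⟩ := exists_add_sub_mul_sub_eq hF s (-s)
  rw [add_neg_cancel, x_zero] at hh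
  linear_combination hh

end FormalGroupAlgebra

/-! ### The localization and the Demazure elements -/

section

variable {R : Type*} [CommRing R] {F : FormalGroup R} {ι Λ Λd : Type*} [AddCommGroup Λ]
  [AddCommGroup Λd] (P : RootDatum ι Λ Λd)

namespace RootLocalization

open FormalGroupAlgebra (x)

theorem algebraMap_injective
    (hreg : ∀ α : ι, x F (P.root α) ∈ nonZeroDivisors (FormalGroupAlgebra F Λ)) :
    Function.Injective (algebraMap (FormalGroupAlgebra F Λ) (RootLocalization F P)) := by
  refine IsLocalization.injective _ (M := rootSubmonoid F P) ?_
  rw [rootSubmonoid, Submonoid.closure_le]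
  rintro _ ⟨i, rfl⟩
  exact hreg i

variable (F) in
theorem algebraMap_mul_xInv (i : ι) :
    algebraMap (FormalGroupAlgebra F Λ) (RootLocalization F P) (x F (P.root i)) *
      xInv F P (P.root i) = 1 :=
  Ring.mul_inverse_cancel _ (IsLocalization.map_units (M := rootSubmonoid F P) _
    ⟨_, Submonoid.subset_closure ⟨i, rfl⟩⟩)

theorem smul_xInv (w : P.weylGroup) {i j : ι} (h : w • P.root i = P.root j) :
    w • xInv F P (P.root i) = xInv F P (P.root j) := by
  have h1 := congrArg (w • ·) (algebraMap_mul_xInv F P i)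
  simp only [smul_mul', smul_one, smul_algebraMap, FormalGroupAlgebra.smul_x, h] at h1
  have h2 := algebraMap_mul_xInv F P j
  linear_combination xInv F P (P.root j) * h1 - (w • xInv F P (P.root i)) * h2

variable [F.IsComm]

theorem xInv_neg (hF : IsNormal F) (i : ι) :
    xInv F P (-P.root i) = 1 - xInv F P (P.root i) := by
  have h0 := congrArg (algebraMap (FormalGroupAlgebra F Λ) (RootLocalization F P))
    (FormalGroupAlgebra.x_add_x_neg hF (P.root i))
  have h1 := algebraMap_mul_xInv F P i
  have h2 := algebraMap_mul_xInv F P (P.reflectionPerm i i)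
  rw [P.root_reflectionPerm, P.reflection_apply_self] at h2
  rw [map_add, map_mul] at h0
  linear_combination (xInv F P (P.root i) * xInv F P (-P.root i)) * h0 +
    (algebraMap (FormalGroupAlgebra F Λ) (RootLocalization F P) (x F (-P.root i)) *
      xInv F P (-P.root i) - xInv F P (-P.root i)) * h1 + (1 - xInv F P (P.root i)) * h2

theorem kappa_eq (hF : IsNormal F) (i : ι) (t : Λ) :
    kappa F P (P.root i) t = xInv F P (P.root i + t) * (xInv F P (P.root i) + xInv F P t - 1) -
      xInv F P (P.root i) * xInv F P t := by
  rw [kappa, xInv_neg P hF]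
  ring

/-- The coefficient `κ_(α,β)` lies in the formal group algebra: it is the image of the cofactor in
`x_α + x_β - x_α x_β - x_(α+β) = x_α x_β x_(α+β) h`. -/
theorem exists_algebraMap_eq_kappa (hF : IsNormal F) {i j l : ι}
    (hl : P.root i + P.root j = P.root l) :
    ∃ k, algebraMap (FormalGroupAlgebra F Λ) (RootLocalization F P) k =
      kappa F P (P.root i) (P.root j) := by
  obtain ⟨h, hh⟩ := FormalGroupAlgebra.exists_add_sub_mul_sub_eq hF (P.root i) (P.root j)
  refine ⟨h, ?_⟩
  rw [kappa_eq P hF]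
  have hq := congrArg (algebraMap (FormalGroupAlgebra F Λ) (RootLocalization F P)) hh
  simp only [map_sub, map_add, map_mul, hl] at hq ⊢
  have ui : IsUnit (algebraMap (FormalGroupAlgebra F Λ) (RootLocalization F P) (x F (P.root i))) :=
    IsUnit.of_mul_eq_one _ (algebraMap_mul_xInv F P i)
  have uj : IsUnit (algebraMap (FormalGroupAlgebra F Λ) (RootLocalization F P) (x F (P.root j))) :=
    IsUnit.of_mul_eq_one _ (algebraMap_mul_xInv F P j)
  have ul : IsUnit (algebraMap (FormalGroupAlgebra F Λ) (RootLocalization F P) (x F (P.root l))) :=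
    IsUnit.of_mul_eq_one _ (algebraMap_mul_xInv F P l)
  refine (ui.mul uj |>.mul ul).mul_left_cancel ?_
  rw [← hq]
  have hi := algebraMap_mul_xInv F P i
  have hj := algebraMap_mul_xInv F P j
  have hk := algebraMap_mul_xInv F P l
  generalize algebraMap (FormalGroupAlgebra F Λ) (RootLocalization F P) (x F (P.root i)) = X at *
  generalize algebraMap (FormalGroupAlgebra F Λ) (RootLocalization F P) (x F (P.root j)) = Y at *
  generalize algebraMap (FormalGroupAlgebra F Λ) (RootLocalization F P) (x F (P.root l)) = Z at *
  generalize xInv F P (P.root i) = a at *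
  generalize xInv F P (P.root j) = b at *
  generalize xInv F P (P.root l) = c at *
  linear_combination (-(X * a * Y + X * Y * b - X * Y)) * hk + (Z * (Y * b) - Y) * hi +
     (Z - X) * hj

end RootLocalization

open SkewMonoidAlgebra RootLocalization RootPairing

theorem DemazureAlgebra.coe_C (y : FormalGroupAlgebra F Λ) :
    (DemazureAlgebra.C F P y : TwistedAlgebra F P) = single 1 (algebraMap _ _ y) :=
  rfl

theorem DemazureAlgebra.coe_X (i : ι) :
    (DemazureAlgebra.X F P i : TwistedAlgebra F P) = single 1 (xInv F P (P.root i)) -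
      single (weylGroup.ofIdx P i) (xInv F P (P.root i)) := by
  change single 1 _ * (1 - single _ 1) = _
  rw [mul_sub, mul_one, single_mul_single]
  simp only [one_mul, one_smul, mul_one]

variable [F.IsComm]

theorem ofIdx_smul_xInv_root_self (hF : IsNormal F) (i : ι) :
    weylGroup.ofIdx P i • xInv F P (P.root i) = 1 - xInv F P (P.root i) := by
  rw [smul_xInv P _ (j := P.reflectionPerm i i), P.root_reflectionPerm,
    P.reflection_apply_self, xInv_neg P hF]
  rw [weylGroup_ofIdx_smul_root, P.root_reflectionPerm, P.reflection_apply_self,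
    pairing_same]
  module

end

end FormalDemazure

open FormalDemazure in
/-- For roots `α_i`, `α_j` of a base, `P.pairing j i` is the number `(α_i^∨, α_j)`. -/
theorem theorem6p3 {R : Type*} [CommRing R] (F : FormalGroup R) [F.IsComm] (hF : IsNormal F)
    {ι Λ Λd : Type*} [Finite ι] [AddCommGroup Λ] [Module.Finite ℤ Λ] [Module.Free ℤ Λ]
    [AddCommGroup Λd] (P : RootDatum ι Λ Λd) (b : P.Base)
    (hreg : ∀ α : ι, FormalGroupAlgebra.x F (P.root α) ∈ nonZeroDivisors (FormalGroupAlgebra F Λ)) :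
    (∀ α : ι, DemazureAlgebra.X F P α ^ 2 = DemazureAlgebra.X F P α) ∧
    (∀ i ∈ b.support, ∀ j ∈ b.support, P.pairing j i = -1 → P.pairing i j = -1 →
      orderOf (RootPairing.weylGroup.ofIdx P i * RootPairing.weylGroup.ofIdx P j) = 3 ∧
      ∃ k : FormalGroupAlgebra F Λ,
        algebraMap _ (RootLocalization F P) k =
          RootLocalization.kappa F P (P.root i) (P.root j) ∧
        DemazureAlgebra.X F P j * DemazureAlgebra.X F P i * DemazureAlgebra.X F P j -
            DemazureAlgebra.X F P i * DemazureAlgebra.X F P j * DemazureAlgebra.X F P i =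
          (DemazureAlgebra.X F P i - DemazureAlgebra.X F P j) * DemazureAlgebra.C F P k ∧
        RootPairing.weylGroup.ofIdx P i • k = k ∧
        RootPairing.weylGroup.ofIdx P j • k = k) ∧
    (∀ i ∈ b.support, ∀ j ∈ b.support, P.pairing j i = -1 → P.pairing i j = -2 →
      orderOf (RootPairing.weylGroup.ofIdx P i * RootPairing.weylGroup.ofIdx P j) = 4 ∧
      ∃ k : FormalGroupAlgebra F Λ,
        algebraMap _ (RootLocalization F P) k =
          RootLocalization.kappa F P (P.root i) (P.root j) +
            RootLocalization.kappa F P (P.root j) (P.root i + P.root j) ∧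
        DemazureAlgebra.X F P j * DemazureAlgebra.X F P i * DemazureAlgebra.X F P j *
              DemazureAlgebra.X F P i -
            DemazureAlgebra.X F P i * DemazureAlgebra.X F P j * DemazureAlgebra.X F P i *
              DemazureAlgebra.X F P j =
          (DemazureAlgebra.X F P i * DemazureAlgebra.X F P j -
              DemazureAlgebra.X F P j * DemazureAlgebra.X F P i) * DemazureAlgebra.C F P k ∧
        RootPairing.weylGroup.ofIdx P i • k = k ∧
        RootPairing.weylGroup.ofIdx P j • k = k) := by
  have self := ofIdx_smul_xInv_root_self P hF
  have sq := weylGroup_ofIdx_mul_self P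
  have inv := RootLocalization.smul_xInv (F := F) P
  have root_add {i j : ι} (hji : P.pairing j i = -1) :
      P.root (P.reflectionPerm i j) = P.root i + P.root j := by
    rw [P.root_reflectionPerm, P.reflection_apply_root, hji]
    module
  refine ⟨fun i => Subtype.ext ?_, fun i _ j _ hji hij => ?_, fun i _ j _ hji hij => ?_⟩
  · rw [SubmonoidClass.coe_pow, DemazureAlgebra.coe_X]
    exact single_sub_single_sq _ _ (sq i) (self i)
  · have hl := root_add hji
    -- the index of `α_i + α_j`
    set l := P.reflectionPerm i j
    obtain ⟨k, hk⟩ := RootLocalization.exists_algebraMap_eq_kappa P hF hl.symm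
    have hk' := hk
    rw [RootLocalization.kappa_eq P hF, ← hl] at hk'
    have hsb := inv (RootPairing.weylGroup.ofIdx P i) (i := j) (j := l)
      (by rw [weylGroup_ofIdx_smul_root, hl, hji]; module)
    have hsc := inv (RootPairing.weylGroup.ofIdx P i) (i := l) (j := j)
      (by rw [hl, smul_add, weylGroup_ofIdx_smul_root, weylGroup_ofIdx_smul_root, hji,
        RootPairing.pairing_same]; module)
    have hta := inv (RootPairing.weylGroup.ofIdx P j) (i := i) (j := l)
      (by rw [weylGroup_ofIdx_smul_root, hl, hij]; module)
    have htc := inv (RootPairing.weylGroup.ofIdx P j) (i := l) (j := i)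
      (by rw [hl, smul_add, weylGroup_ofIdx_smul_root, weylGroup_ofIdx_smul_root, hij,
        RootPairing.pairing_same]; module)
    refine ⟨orderOf_ofIdx_mul_ofIdx_eq_three P hji hij, k, hk, Subtype.ext ?_, ?_, ?_⟩
    · simp only [Subalgebra.coe_sub, Subalgebra.coe_mul, DemazureAlgebra.coe_X,
        DemazureAlgebra.coe_C, hk']
      exact demazure_braid_three _ _ _ _ _ (sq i) (sq j) (weylGroup_braid_three P hji hij)
        (self i) hsb hsc hta (self j) htc
    · refine RootLocalization.algebraMap_injective P hreg ?_
      simp only [← RootLocalization.smul_algebraMap, hk', smul_sub, smul_mul', smul_add, smul_one,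
        self, hsb, hsc]
      ring
    · refine RootLocalization.algebraMap_injective P hreg ?_
      simp only [← RootLocalization.smul_algebraMap, hk', smul_sub, smul_mul', smul_add, smul_one,
        self, hta, htc]
      ring
  · have hl := root_add hji
    -- the index of `α_i + α_j`
    set l := P.reflectionPerm i j
    have hm : P.root (P.reflectionPerm j i) = P.root j + P.root l := by
      rw [P.root_reflectionPerm, P.reflection_apply_root, hij, hl]
      module
    -- the index of `α_i + 2 α_j`
    set m := P.reflectionPerm j i
    obtain ⟨k₁, hk₁⟩ := RootLocalization.exists_algebraMap_eq_kappa P hF hl.symm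
    obtain ⟨k₂, hk₂⟩ := RootLocalization.exists_algebraMap_eq_kappa P hF hm.symm
    have hk : algebraMap _ (RootLocalization F P) (k₁ + k₂) =
        RootLocalization.kappa F P (P.root i) (P.root j) +
          RootLocalization.kappa F P (P.root j) (P.root i + P.root j) := by
      rw [map_add, hk₁, hk₂, hl]
    have hk' := hk
    rw [RootLocalization.kappa_eq P hF, RootLocalization.kappa_eq P hF, ← hl, ← hm] at hk'
    have hsb := inv (RootPairing.weylGroup.ofIdx P i) (i := j) (j := l)
      (by rw [weylGroup_ofIdx_smul_root, hl, hji]; module)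
    have hsc := inv (RootPairing.weylGroup.ofIdx P i) (i := l) (j := j)
      (by rw [hl, smul_add, weylGroup_ofIdx_smul_root, weylGroup_ofIdx_smul_root, hji,
        RootPairing.pairing_same]; module)
    have hsd := inv (RootPairing.weylGroup.ofIdx P i) (i := m) (j := m)
      (by rw [hm, hl, smul_add, smul_add, weylGroup_ofIdx_smul_root, weylGroup_ofIdx_smul_root,
        hji, RootPairing.pairing_same]; module)
    have hta := inv (RootPairing.weylGroup.ofIdx P j) (i := i) (j := m)
      (by rw [weylGroup_ofIdx_smul_root, hm, hl, hij]; module)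
    have htc := inv (RootPairing.weylGroup.ofIdx P j) (i := l) (j := l)
      (by rw [hl, smul_add, weylGroup_ofIdx_smul_root, weylGroup_ofIdx_smul_root, hij,
        RootPairing.pairing_same]; module)
    have htd := inv (RootPairing.weylGroup.ofIdx P j) (i := m) (j := i)
      (by rw [hm, hl, smul_add, smul_add, weylGroup_ofIdx_smul_root, weylGroup_ofIdx_smul_root,
        hij, RootPairing.pairing_same]; module)
    refine ⟨orderOf_ofIdx_mul_ofIdx_eq_four P hji hij, k₁ + k₂, hk, Subtype.ext ?_, ?_, ?_⟩
    · simp only [Subalgebra.coe_sub, Subalgebra.coe_mul, DemazureAlgebra.coe_X,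
        DemazureAlgebra.coe_C, hk']
      exact demazure_braid_four _ _ _ _ _ _ (sq i) (sq j) (weylGroup_braid_four P hji hij)
        (self i) hsb hsc hsd hta (self j) htc htd
    · refine RootLocalization.algebraMap_injective P hreg ?_
      rw [← RootLocalization.smul_algebraMap, hk']
      simp only [smul_sub, smul_mul', smul_add, smul_one, self, hsb, hsc, hsd]
      ring
    · refine RootLocalization.algebraMap_injective P hreg ?_
      rw [← RootLocalization.smul_algebraMap, hk']
      simp only [smul_sub, smul_mul', smul_add, smul_one, self, hta, htc, htd]
      ring
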